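/- Let $G$ be a locally compact abelian (Hausdorff) group. A cut-and-project scheme $(G,H,\mathcal L)$ consists of a locally compact abelian group $H$ and a discrete and cocompact subgroup $\mathcal L\subseteq G\times H$ which projects injectively to $G$ and densely to $H$. For $W\subseteq H$ put $\Lambda_W=\pi^G(\mathcal L\cap(G\times W))$, where $\pi^G\colon G\times H\to G$ is the projection. Consider a set $\Gamma\subseteq G$. (1) $\Gamma$ is a regular model set if there are a cut-and-project scheme $(G,H,\mathcal L)$ and a relatively compact Borel set $W\subseteq H$ with non-empty interior $W^\circ$ and with boundary $\partial W=\overline W\setminus W^\circ$ of zero Haar measure such that $\Gamma=\Lambda_W$. (2) $\Gamma$ is an inter regular model set if there are a cut-and-project scheme $(G,H,\mathcal L)$ and $W\subseteq H$ as in (1) such that $\Lambda_{W^\circ}\subseteq\Gamma\subseteq\Lambda_{\overline W}$. (3) $\Gamma$ is an almost regular model set if there are a cut-and-project scheme $(G,H,\mathcal L)$ and sets $U\subseteq W\subseteq H$, with $U$ non-empty and open, $W$ compact and $W\setminus U$ of zero Haar measure, such that $\Lambda_U\subseteq\Gamma\subseteq\Lambda_W$. For a locally finite set $\Gamma\subseteq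 G$, the hull $\mathbb X(\Gamma)$ is the set of all locally finite $\Gamma'\subseteq G$ such that $\sum_{x\in\Gamma'}\delta_x$ lies in the closure of $\{\sum_{x\in s+\Gamma}\delta_x : s\in G\}$ in the vague topology, i.e. the topology of pointwise convergence on the continuous functions $G\to\mathbb R$ with compact support. (All sets in (1)--(3) are locally finite.) Claim: if $\Gamma$ is an almost regular model set, then there exists some $\Gamma'\in\mathbb X(\Gamma)$ which is a regular model set. In particular, if $\Gamma$ is an inter regular model set, then there exists some $\Gamma'\in\mathbb X(\Gamma)$ which is a regular model set. -/

import Mathlib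

open MeasureTheory Set

open scoped CompactlySupported

universe u

/-- A cut-and-project scheme with direct space `G` and internal space `H`: a lattice in `G × H`,
that is, a discrete and cocompact subgroup, which projects injectively to `G` and densely to `H`. -/
structure CutAndProjectScheme (G H : Type u) [AddCommGroup G] [TopologicalSpace G]
    [AddCommGroup H] [TopologicalSpace H] where
  lattice : AddSubgroup (G × H)
  discrete : DiscreteTopology lattice
  cocompact : CompactSpace ((G × H) ⧸ lattice)
  injOn_fst : InjOn Prod.fst (lattice : Set (G × H))
  dense_snd : Dense (Prod.snd '' (lattice : Set (G × H)))

/-- The projection set `Λ_W = π^G (L ∩ (G × W))`. -/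
def CutAndProjectScheme.projectionSet {G H : Type u} [AddCommGroup G] [TopologicalSpace G]
    [AddCommGroup H] [TopologicalSpace H] (S : CutAndProjectScheme G H) (W : Set H) : Set G :=
  Prod.fst '' ((S.lattice : Set (G × H)) ∩ (univ ×ˢ W))

/-- A window of a regular model set: relatively compact, Borel measurable, with non-empty interior
and with a topological boundary of zero Haar measure. -/
structure IsRegularWindow {H : Type u} [AddCommGroup H] [TopologicalSpace H]
    [IsTopologicalAddGroup H] [LocallyCompactSpace H] [MeasurableSpace H] [BorelSpace H]
    (W : Set H) : Prop where
  isCompact_closure : IsCompact (closure W)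
  measurableSet : MeasurableSet W
  interior_nonempty : (interior W).Nonempty
  haar_frontier : Measure.addHaar (frontier W) = 0

section

variable {G : Type u} [AddCommGroup G] [TopologicalSpace G]

/-- `Γ` is a regular model set: `Γ = Λ_W` for a regular window `W` in some
cut-and-project scheme with direct space `G`. -/
def IsRegularModelSet (Γ : Set G) : Prop :=
  ∃ (H : Type u) (_ : AddCommGroup H) (_ : TopologicalSpace H) (_ : IsTopologicalAddGroup H)
    (_ : LocallyCompactSpace H) (_ : T2Space H) (_ : MeasurableSpace H) (_ : BorelSpace H)
    (S : CutAndProjectScheme G H) (W : Set H),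
    IsRegularWindow W ∧ Γ = S.projectionSet W

/-- `Γ` is an inter regular model set: `Λ_{int W} ⊆ Γ ⊆ Λ_{cl W}` for a regular window `W` in some
cut-and-project scheme with direct space `G`. -/
def IsInterRegularModelSet (Γ : Set G) : Prop :=
  ∃ (H : Type u) (_ : AddCommGroup H) (_ : TopologicalSpace H) (_ : IsTopologicalAddGroup H)
    (_ : LocallyCompactSpace H) (_ : T2Space H) (_ : MeasurableSpace H) (_ : BorelSpace H)
    (S : CutAndProjectScheme G H) (W : Set H),
    IsRegularWindow W ∧ S.projectionSet (interior W) ⊆ Γ ∧ Γ ⊆ S.projectionSet (closure W)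

/-- `Γ` is an almost regular model set: `Λ_U ⊆ Γ ⊆ Λ_W` in some cut-and-project scheme with direct
space `G`, where `U ⊆ W`, `U` is non-empty and open, `W` is compact, and `W \ U` has vanishing
Haar measure. -/
def IsAlmostRegularModelSet (Γ : Set G) : Prop :=
  ∃ (H : Type u) (_ : AddCommGroup H) (_ : TopologicalSpace H) (_ : IsTopologicalAddGroup H)
    (_ : LocallyCompactSpace H) (_ : T2Space H) (_ : MeasurableSpace H) (_ : BorelSpace H)
    (S : CutAndProjectScheme G H) (U W : Set H),
    U ⊆ W ∧ U.Nonempty ∧ IsOpen U ∧ IsCompact W ∧ Measure.addHaar (W \ U) = 0 ∧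
      S.projectionSet U ⊆ Γ ∧ Γ ⊆ S.projectionSet W

/-- The Dirac comb `∑_{x ∈ Γ} δ_x` of a locally finite set `Γ`, as a functional on the compactly
supported continuous functions; all the sums are finite for such `Γ`. -/
noncomputable def diracComb (Γ : Set G) : C_c(G, ℝ) → ℝ :=
  fun f => ∑ᶠ x ∈ Γ, f x

/-- The hull of a locally finite set `Γ`: the locally finite sets `Γ'` whose Dirac comb lies in
the vague closure of the set of Dirac combs of the translates `s + Γ`. The vague topology is that
of pointwise convergence on test functions, which is the product topology on `C_c(G, ℝ) → ℝ`. -/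
def hull (Γ : Set G) : Set (Set G) :=
  {Γ' | (∀ K : Set G, IsCompact K → (Γ' ∩ K).Finite) ∧
    diracComb Γ' ∈ closure (range fun s : G => diracComb ((fun x => s + x) '' Γ))}

end

/-! `Γ` itself is a regular model set, for a larger internal space; so `Γ' = Γ` works. Over `H` one
would add to `U` the lattice points over `Γ`, but distinct lattice points may share their
`H`-coordinate, and an arbitrary set of lattice points need not be Borel.

Both defects vanish after replacing `H` by the closure of the graph of an injective homomorphism `ψ`
from the lattice to a compact group `K`. The projection `p` back to `H` is proper and surjective, so
it sends Haar measure to Haar measure, and the window `p ⁻¹' U ∪ E`, with `E` the lattice points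
over `Γ`, has its frontier in the null set `p ⁻¹' (W \ U)`.

For `E` to be Borel, `ψ` takes values in the finitely supported families in a power of the circle
with entries in a countable subgroup: every set of lattice points is then a countable union of
discrete sets. -/

/-! ### Embedding abelian groups into sums of a countable divisible group -/

/-- The homomorphism `(a, b) ↦ a + b √2` to the circle. Its range is countable, divisible and
contains a copy of every cyclic group. -/
noncomputable def circleHom : ℚ × ℚ →+ UnitAddCircle :=
  (QuotientAddGroup.mk' (AddSubgroup.zmultiples (1 : ℝ))).comp
    { toFun := fun q => (q.1 : ℝ) + q.2 * √2
      map_zero' := by simp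
      map_add' := fun x y => by push_cast [Prod.fst_add, Prod.snd_add]; ring }

theorem circleHom_apply (q : ℚ × ℚ) :
    circleHom q = (((q.1 : ℝ) + q.2 * √2 : ℝ) : UnitAddCircle) := rfl

theorem exists_mem_range_circleHom_addOrderOf_eq (n : ℕ) :
    ∃ a ∈ circleHom.range, addOrderOf a = n := by
  obtain rfl | hn := Nat.eq_zero_or_pos n
  · refine ⟨circleHom (0, 1), ⟨_, rfl⟩, ?_⟩
    rw [addOrderOf_eq_zero_iff, circleHom_apply, AddCircle.isOfFinAddOrder_iff_exists_rat_eq_div]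
    rintro ⟨q, hq⟩
    exact irrational_sqrt_two ⟨q, by simpa using hq⟩
  · refine ⟨circleHom (1 / n, 0), ⟨_, rfl⟩, ?_⟩
    rw [circleHom_apply]
    have := AddCircle.addOrderOf_period_div (p := (1 : ℝ)) hn
    simpa using this

instance : Countable circleHom.range :=
  (Set.countable_range circleHom).to_subtype

/-- Divisible groups are injective over `ℤ`, and divisibility passes from a rational vector space to
its quotients. -/
theorem baer_finsupp_range_circleHom (ι : Type u) : Module.Baer ℤ (ι →₀ circleHom.range) := by
  let : DivisibleBy (ι →₀ ℚ × ℚ) ℤ :=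
    { div := fun x n => (n : ℚ)⁻¹ • x
      div_zero := fun x => by simp
      div_cancel := fun {n} x hn => by
        have hn' : (n : ℚ) ≠ 0 := by exact_mod_cast hn
        rw [← Int.cast_smul_eq_zsmul ℚ, smul_smul, mul_inv_cancel₀ hn', one_smul] }
  have hs : Function.Surjective
      (Finsupp.mapRange.addMonoidHom (ι := ι) circleHom.rangeRestrict) := by
    exact Finsupp.mapRange_surjective (α := ι) _ (map_zero circleHom.rangeRestrict)
      circleHom.rangeRestrict_surjective
  let : DivisibleBy (ι →₀ circleHom.range) ℤ :=
    hs.divisibleBy _ fun a n => map_zsmul _ n a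
  exact Module.Baer.of_divisible _

theorem exists_injective_span_singleton_addMonoidHom {L : Type u} [AddCommGroup L] (x : L) :
    ∃ e : Submodule.span ℤ {x} →+ circleHom.range, Function.Injective e := by
  obtain ⟨a, ha, hax⟩ := exists_mem_range_circleHom_addOrderOf_eq (addOrderOf x)
  have hx : ∀ y : Submodule.span ℤ {x}, y ∈ AddSubgroup.zmultiples
      (⟨x, Submodule.mem_span_singleton_self x⟩ : Submodule.span ℤ {x}) := by
    rintro ⟨y, hy⟩
    obtain ⟨n, rfl⟩ := Submodule.mem_span_singleton.1 hy
    exact ⟨n, rfl⟩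
  have ha' : ∀ y : AddSubgroup.zmultiples a, y ∈ AddSubgroup.zmultiples
      (⟨a, AddSubgroup.mem_zmultiples a⟩ : AddSubgroup.zmultiples a) := by
    rintro ⟨_, n, rfl⟩
    exact ⟨n, rfl⟩
  have hle : AddSubgroup.zmultiples a ≤ circleHom.range := by
    rwa [AddSubgroup.zmultiples_le]
  refine ⟨(AddSubgroup.inclusion hle).comp (addEquivOfAddOrderOfEq hx ha' ?_).toAddMonoidHom,
    (AddSubgroup.inclusion_injective hle).comp (AddEquiv.injective _)⟩
  rw [← AddSubgroup.addOrderOf_coe (⟨a, _⟩ : AddSubgroup.zmultiples a), hax]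
  exact (addOrderOf_injective (Submodule.span ℤ {x}).toAddSubgroup.subtype
    Subtype.val_injective ⟨x, _⟩).symm ▸ rfl

theorem sSupIndep.insert_of_disjoint {α : Type*} [CompleteLattice α] [IsModularLattice α]
    {s : Set α} (hs : sSupIndep s) {a : α} (ha : Disjoint a (sSup s)) :
    sSupIndep (insert a s) := by
  rintro b (rfl | hb)
  · exact ha.mono_right (sSup_le_sSup (by simp))
  · have h : Disjoint b (sSup (s \ {b}) ⊔ a) := by
      refine (hs hb).disjoint_sup_right_of_disjoint_sup_left (ha.symm.mono_left ?_)
      exact sup_le (le_sSup hb) (sSup_le_sSup sdiff_subset)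
    refine h.mono_right (sSup_le ?_)
    rintro c ⟨rfl | hc, hcb⟩
    · exact le_sup_right
    · exact (le_sSup (show c ∈ s \ {b} from ⟨hc, hcb⟩)).trans le_sup_left

/-- Every abelian group has an independent family of cyclic subgroups whose sum is essential. -/
theorem exists_sSupIndep_span_singleton (L : Type u) [AddCommGroup L] :
    ∃ s : Set (Submodule ℤ L), sSupIndep s ∧ (∀ N ∈ s, ∃ x, N = Submodule.span ℤ {x}) ∧
      ∀ M : Submodule ℤ L, Disjoint M (sSup s) → M = ⊥ := by
  obtain ⟨s, hs⟩ := zorn_subset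
    {s : Set (Submodule ℤ L) | sSupIndep s ∧ ∀ N ∈ s, ∃ x, N = Submodule.span ℤ {x}}
    fun c hc hchain => ⟨⋃₀ c,
      ⟨iSupIndep_sUnion_of_directed hchain.directedOn fun t ht => (hc ht).1,
        fun N ⟨t, ht, hN⟩ => (hc ht).2 N hN⟩,
      fun t ht => subset_sUnion_of_mem ht⟩
  -- A cyclic subgroup disjoint from the sum could be added to `s`, so by maximality it already lies
  -- in `s`, hence is zero.
  refine ⟨s, hs.prop.1, hs.prop.2, fun M hM => (Submodule.eq_bot_iff M).2 fun y hy => ?_⟩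
  have hd : Disjoint (Submodule.span ℤ {y}) (sSup s) :=
    hM.mono_left ((Submodule.span_singleton_le_iff_mem y M).2 hy)
  have hmem : Submodule.span ℤ {y} ∈ s := by
    refine hs.mem_of_prop_insert ⟨hs.prop.1.insert_of_disjoint hd, ?_⟩
    rintro N (rfl | hN)
    exacts [⟨y, rfl⟩, hs.prop.2 N hN]
  have := hd.eq_bot_of_le (le_sSup hmem)
  simpa using this

/-- Every abelian group embeds into a direct sum of copies of a countable subgroup of the
circle. -/
theorem exists_injective_addMonoidHom_finsupp (L : Type u) [AddCommGroup L] :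
    ∃ (ι : Type u) (f : L →+ (ι →₀ circleHom.range)), Function.Injective f := by
  classical
  obtain ⟨s, hind, hcyc, hess⟩ := exists_sSupIndep_span_singleton L
  have hN : ∀ N : s, ∃ e : (N : Submodule ℤ L) →+ circleHom.range, Function.Injective e := by
    rintro ⟨N, hN⟩
    obtain ⟨x, rfl⟩ := hcyc N hN
    exact exists_injective_span_singleton_addMonoidHom x
  choose e he using hN
  have hj := ((sSupIndep_iff s).1 hind).dfinsupp_lsum_injective
  set j : (Π₀ N : s, (N : Submodule ℤ L)) →ₗ[ℤ] L :=
    DFinsupp.lsum ℕ fun N : s => (N : Submodule ℤ L).subtype with hjdef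
  let g : (Π₀ N : s, (N : Submodule ℤ L)) →+ (s →₀ circleHom.range) :=
    (finsuppAddEquivDFinsupp.symm.toAddMonoidHom).comp (DFinsupp.mapRange.addMonoidHom e)
  have hg : Function.Injective g :=
    finsuppAddEquivDFinsupp.symm.injective.comp
      ((DFinsupp.mapRange_injective _ fun N => map_zero (e N)).2 he)
  -- Injectivity of the target extends `g` to all of `L`; the kernel of the extension misses the
  -- essential subgroup, so it is zero.
  obtain ⟨f, hf⟩ := (baer_finsupp_range_circleHom s).extension_property_addMonoidHom
    j.toAddMonoidHom hj g
  refine ⟨s, f, (injective_iff_map_eq_zero f).2 fun y hy => ?_⟩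
  have hker : LinearMap.ker f.toIntLinearMap = ⊥ := by
    refine hess _ (Submodule.disjoint_def.2 fun z hz hzs => ?_)
    rw [sSup_eq_iSup', Submodule.mem_iSup_iff_exists_dfinsupp] at hzs
    obtain ⟨w, rfl⟩ := hzs
    have h0 : g w = 0 := (DFunLike.congr_fun hf w).symm.trans hz
    rw [(map_eq_zero_iff g hg).1 h0, map_zero]
  exact (Submodule.eq_bot_iff _).1 hker y hy

/-! ### Borel measurability of σ-discrete sets -/

/-- A discrete set in a T1 space is open in its closure. -/
theorem IsDiscrete.measurableSet_of_t1 {X : Type*} [TopologicalSpace X] [T1Space X]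
    [MeasurableSpace X] [BorelSpace X] {D : Set X} (hD : IsDiscrete D) : MeasurableSet D := by
  choose! O hO hOD using isDiscrete_iff_forall_mem_exists_isOpen.1 hD
  have h : D = closure D ∩ ⋃ x ∈ D, O x := by
    refine Subset.antisymm (fun x hx => ⟨subset_closure hx, mem_biUnion hx ?_⟩) ?_
    · exact ((hOD x hx).symm ▸ mem_singleton x : x ∈ O x ∩ D).1
    · rintro y ⟨hyD, hy⟩
      obtain ⟨x, hx, hyx⟩ := mem_iUnion₂.1 hy
      have := (hO x hx).inter_closure ⟨hyx, hyD⟩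
      rw [hOD x hx, closure_singleton, mem_singleton_iff] at this
      exact this ▸ hx
  rw [h]
  exact isClosed_closure.measurableSet.inter (isOpen_biUnion hO).measurableSet

/-- A set which is mapped injectively to finitely supported families with countably many values is
`σ`-discrete, and therefore Borel. -/
theorem measurableSet_of_injOn_finsupp {X ι T : Type*} [TopologicalSpace X] [T1Space X]
    [MeasurableSpace X] [BorelSpace X] [AddGroup T] [TopologicalSpace T] [T1Space T]
    {A : AddSubgroup T} [Countable A] {c : X → ι → T} (hc : Continuous c) {E : Set X}
    {a : X → ι →₀ A} (ha : InjOn a E) (hac : ∀ x ∈ E, ∀ i, c x i = a x i) : MeasurableSet E := by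
  classical
  -- Fixing the support size and a finite set of allowed values makes each piece discrete.
  let D : ℕ × Finset A → Set X :=
    fun p => {x ∈ E | (a x).support.card = p.1 ∧ ∀ i ∈ (a x).support, a x i ∈ p.2}
  have hE : E = ⋃ p, D p := by
    refine Subset.antisymm (fun x hx => mem_iUnion.2
      ⟨((a x).support.card, (a x).support.image (a x)), hx, rfl, fun i hi => ?_⟩)
      (iUnion_subset fun p x hx => hx.1)
    exact Finset.mem_image_of_mem _ hi
  rw [hE]
  refine MeasurableSet.iUnion fun ⟨n, F⟩ => IsDiscrete.measurableSet_of_t1 ?_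
  refine isDiscrete_iff_forall_mem_exists_isOpen.2 fun x hx => ?_
  -- Avoiding the other values in `F`, and `0`, forces agreement with `a x` on its support; equal
  -- support sizes then exclude further nonzero entries.
  refine ⟨⋂ i ∈ (a x).support, {y | c y i ∉ ((↑) '' ((insert 0 F).erase (a x i) : Set A) : Set T)},
    ?_, ?_⟩
  · refine isOpen_biInter_finset fun i _ => ?_
    exact (((Finset.finite_toSet _).image _).isClosed.isOpen_compl).preimage
      ((continuous_apply i).comp hc)
  · refine Subset.antisymm ?_ ?_
    · rintro y ⟨hy, hyD⟩
      have hval : ∀ i ∈ (a x).support, a y i = a x i := by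
        intro i hi
        have h1 := mem_iInter₂.1 hy i hi
        by_contra hne
        refine h1 ⟨a y i, ?_, (hac y hyD.1 i).symm⟩
        rw [Finset.mem_coe, Finset.mem_erase]
        refine ⟨hne, ?_⟩
        by_cases h0 : a y i = 0
        · simp [h0]
        · exact Finset.mem_insert_of_mem (hyD.2.2 i (Finsupp.mem_support_iff.2 h0))
      have hsub : (a x).support ⊆ (a y).support := fun i hi => by
        rw [Finsupp.mem_support_iff, hval i hi]
        exact Finsupp.mem_support_iff.1 hi
      have hsupp := Finset.eq_of_subset_of_card_le hsub (hyD.2.1.trans hx.2.1.symm).le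
      refine ha hyD.1 hx.1 (Finsupp.ext fun i => ?_)
      by_cases hi : i ∈ (a x).support
      · exact hval i hi
      · rw [Finsupp.notMem_support_iff.1 hi, Finsupp.notMem_support_iff.1 (hsupp ▸ hi)]
    · rintro _ rfl
      refine ⟨mem_iInter₂.2 fun i _ => ?_, hx⟩
      rintro ⟨b, hb, hbx⟩
      rw [hac _ hx.1 i] at hbx
      exact (Finset.mem_erase.1 hb).1 (Subtype.ext hbx)

/-! ### Extending the internal space by a compact group -/

/-- A cocompact subgroup of a locally compact group has a compact set of representatives. -/
theorem AddSubgroup.exists_isCompact_forall_exists_sub_mem {X : Type*} [AddCommGroup X]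
    [TopologicalSpace X] [IsTopologicalAddGroup X] [LocallyCompactSpace X] (N : AddSubgroup X)
    [CompactSpace (X ⧸ N)] : ∃ C : Set X, IsCompact C ∧ ∀ x, ∃ l ∈ N, x - l ∈ C := by
  choose K hK hKx using fun x : X => exists_compact_mem_nhds x
  obtain ⟨t, ht⟩ := (isCompact_univ (X := X ⧸ N)).elim_finite_subcover
    (fun x : X => QuotientAddGroup.mk '' interior (K x))
    (fun x => QuotientAddGroup.isOpenMap_coe _ isOpen_interior)
    (fun q _ => by
      obtain ⟨x, rfl⟩ := QuotientAddGroup.mk_surjective q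
      exact mem_iUnion.2 ⟨x, x, mem_interior_iff_mem_nhds.2 (hKx x), rfl⟩)
  refine ⟨⋃ x ∈ t, K x, t.isCompact_biUnion fun x _ => hK x, fun y => ?_⟩
  obtain ⟨x, hx, z, hz, hzy⟩ := mem_iUnion₂.1 (ht (mem_univ (y : X ⧸ N)))
  refine ⟨-z + y, QuotientAddGroup.eq.1 hzy, mem_biUnion hx ?_⟩
  rw [show y - (-z + y) = z by abel]
  exact interior_subset hz

namespace CutAndProjectScheme

variable {G H K : Type u} [AddCommGroup G] [TopologicalSpace G]
  [AddCommGroup H] [TopologicalSpace H] [IsTopologicalAddGroup H]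
  [AddCommGroup K] [TopologicalSpace K] [IsTopologicalAddGroup K]
  (S : CutAndProjectScheme G H) (ψ : S.lattice →+ K)

/-- The homomorphism `(g, h) ↦ (h, ψ (g, h))` on the lattice. -/
def internalHom : S.lattice →+ H × K :=
  ((AddMonoidHom.snd G H).comp S.lattice.subtype).prod ψ

/-- The closure of the set of all `(h, ψ (g, h))` for `(g, h)` in the lattice. -/
abbrev InternalExtension : Type u := (S.internalHom ψ).range.topologicalClosure

/-- The projection of the extended internal space to the original one. -/
def internalProj : S.InternalExtension ψ →+ H :=
  (AddMonoidHom.fst H K).comp (AddSubgroup.subtype _)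

/-- The second coordinate of a point of the extended internal space. -/
def internalCoord (x : S.InternalExtension ψ) : K := x.1.2

/-- The point `(h, ψ (g, h))` of the extended internal space. -/
def internalMk : S.lattice →+ S.InternalExtension ψ :=
  (AddSubgroup.inclusion (AddSubgroup.le_topologicalClosure _)).comp
    (S.internalHom ψ).rangeRestrict

theorem continuous_internalCoord : Continuous (S.internalCoord ψ) :=
  continuous_snd.comp continuous_subtype_val

theorem dense_range_internalMk : DenseRange (S.internalMk ψ) := by
  rw [DenseRange, Subtype.dense_iff, ← range_comp]
  exact (AddSubgroup.topologicalClosure_coe (s := (S.internalHom ψ).range)).le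

theorem isProperMap_internalProj [CompactSpace K] : IsProperMap (S.internalProj ψ) :=
  isProperMap_fst_of_compactSpace.comp
    (AddSubgroup.isClosed_topologicalClosure _).isClosedEmbedding_subtypeVal.isProperMap

/-- The range is closed by properness and contains the dense projection of the lattice. -/
theorem surjective_internalProj [CompactSpace K] :
    Function.Surjective (S.internalProj ψ) := by
  rw [← range_eq_univ, ← (S.isProperMap_internalProj ψ).isClosedMap.isClosed_range.closure_eq]
  refine (S.dense_snd.mono ?_).closure_eq
  rintro _ ⟨l, hl, rfl⟩
  exact ⟨S.internalMk ψ ⟨l, hl⟩, rfl⟩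

instance [LocallyCompactSpace H] [CompactSpace K] :
    LocallyCompactSpace (S.InternalExtension ψ) :=
  (AddSubgroup.isClosed_topologicalClosure _).isClosedEmbedding_subtypeVal.locallyCompactSpace

/-- The embedding `(g, h) ↦ (g, (h, ψ (g, h)))` of the lattice. -/
def latticeHom : S.lattice →+ G × S.InternalExtension ψ :=
  ((AddMonoidHom.fst G H).comp S.lattice.subtype).prod (S.internalMk ψ)

/-- The cut-and-project scheme whose internal space is extended by a homomorphism from the lattice
to a compact group. -/
def extend [IsTopologicalAddGroup G] [LocallyCompactSpace G] [LocallyCompactSpace H] [CompactSpace K] :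
    CutAndProjectScheme G (S.InternalExtension ψ) where
  lattice := (S.latticeHom ψ).range
  discrete := by
    have := S.discrete
    have hmem : ∀ x : (S.latticeHom ψ).range,
        (x.1.1, S.internalProj ψ x.1.2) ∈ S.lattice := by
      rintro ⟨_, l, rfl⟩
      exact l.2
    refine DiscreteTopology.of_continuous_injective
      (f := fun x : (S.latticeHom ψ).range => (⟨_, hmem x⟩ : S.lattice)) ?_ ?_
    · exact ((continuous_fst.comp continuous_subtype_val).prodMk
        ((S.isProperMap_internalProj ψ).continuous.comp
          (continuous_snd.comp continuous_subtype_val))).subtype_mk _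
    · rintro ⟨_, l, rfl⟩ ⟨_, l', rfl⟩ h
      have : l = l' := h
      rw [this]
  cocompact := by
    have := S.cocompact
    obtain ⟨C, hC, hCx⟩ := S.lattice.exists_isCompact_forall_exists_sub_mem
    -- By properness, representatives modulo the old lattice pull back to a compact set of
    -- representatives modulo the new one.
    have hC' := ((isProperMap_id (X := G)).prodMap
      (S.isProperMap_internalProj ψ)).isCompact_preimage hC
    refine ⟨(hC'.image continuous_quot_mk).of_isClosed_subset isClosed_univ fun q _ => ?_⟩
    obtain ⟨x, rfl⟩ := QuotientAddGroup.mk_surjective q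
    obtain ⟨l, hl, hlC⟩ := hCx (x.1, S.internalProj ψ x.2)
    refine ⟨x - S.latticeHom ψ ⟨l, hl⟩, ?_, ?_⟩
    · convert! hlC using 1
    · refine QuotientAddGroup.eq.2 ⟨⟨l, hl⟩, ?_⟩
      abel
  injOn_fst := by
    rintro _ ⟨l, rfl⟩ _ ⟨l', rfl⟩ h
    rw [Subtype.ext (S.injOn_fst l.2 l'.2 h)]
  dense_snd := by
    refine (S.dense_range_internalMk ψ).mono ?_
    rintro _ ⟨l, rfl⟩
    exact ⟨S.latticeHom ψ l, ⟨l, rfl⟩, rfl⟩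

theorem mem_projectionSet_extend [IsTopologicalAddGroup G] [LocallyCompactSpace G]
    [LocallyCompactSpace H] [CompactSpace K]
    {V : Set (S.InternalExtension ψ)} {g : G} : g ∈ (S.extend ψ).projectionSet V ↔
      ∃ l : S.lattice, S.internalMk ψ l ∈ V ∧ (l : G × H).1 = g := by
  constructor
  · rintro ⟨_, ⟨⟨l, rfl⟩, -, hl⟩, rfl⟩
    exact ⟨l, hl, rfl⟩
  · rintro ⟨l, hl, rfl⟩
    exact ⟨S.latticeHom ψ l, ⟨⟨l, rfl⟩, trivial, hl⟩, rfl⟩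

/-- The pushforward of Haar measure is a Haar measure on `H`. Without regularity, uniqueness up to a
scalar is used only on sets with compact closure, hence the compactness of `N`. -/
theorem addHaar_preimage_internalProj_eq_zero [LocallyCompactSpace H] [T2Space H]
    [MeasurableSpace H] [BorelSpace H] [CompactSpace K]
    [MeasurableSpace (S.InternalExtension ψ)] [BorelSpace (S.InternalExtension ψ)]
    {N : Set H} (hN : IsCompact N) (h0 : Measure.addHaar N = 0) :
    Measure.addHaar (S.internalProj ψ ⁻¹' N) = 0 := by
  have hp := S.isProperMap_internalProj ψ
  have := Measure.isAddHaarMeasure_map (Measure.addHaar (G := S.InternalExtension ψ))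
    (S.internalProj ψ) hp.continuous (S.surjective_internalProj ψ) (isProperMap_iff_tendsto_cocompact.1 hp).2
  rw [← Measure.map_apply hp.continuous.measurable hN.measurableSet,
    Measure.measure_isAddInvariant_eq_smul_of_isCompact_closure _ Measure.addHaar hN.closure, h0,
    smul_zero]

theorem finite_projectionSet_inter [IsTopologicalAddGroup G] [T2Space G] [T2Space H] {W : Set H} (hW : IsCompact W)
    {C : Set G} (hC : IsCompact C) : (S.projectionSet W ∩ C).Finite := by
  have := S.discrete
  have hcl : IsClosed (S.lattice : Set (G × H)) := AddSubgroup.isClosed_of_discrete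
  have hd : IsDiscrete (S.lattice : Set (G × H)) := isDiscrete_iff_discreteTopology.2 this
  have hfin : ((C ×ˢ W) ∩ (S.lattice : Set (G × H))).Finite :=
    ((hC.prod hW).inter_right hcl).finite (hd.mono inter_subset_right)
  refine (hfin.image Prod.fst).subset ?_
  rintro _ ⟨⟨x, ⟨hx, -, hxW⟩, rfl⟩, hxC⟩
  exact ⟨x, ⟨⟨hxC, hxW⟩, hx⟩, rfl⟩

end CutAndProjectScheme

/-! ### Almost regular model sets are regular -/

section

variable {G : Type u} [AddCommGroup G] [TopologicalSpace G]

theorem mem_hull_self {Γ : Set G} (h : ∀ C : Set G, IsCompact C → (Γ ∩ C).Finite) :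
    Γ ∈ hull Γ :=
  ⟨h, subset_closure ⟨0, by simp⟩⟩

theorem IsInterRegularModelSet.isAlmostRegularModelSet {Γ : Set G}
    (h : IsInterRegularModelSet Γ) : IsAlmostRegularModelSet Γ := by
  obtain ⟨H, i₁, i₂, i₃, i₄, i₅, i₆, i₇, S, W, hW, h₁, h₂⟩ := h
  exact ⟨H, i₁, i₂, i₃, i₄, i₅, i₆, i₇, S, interior W, closure W,
    interior_subset.trans subset_closure, hW.interior_nonempty, isOpen_interior,
    hW.isCompact_closure, hW.haar_frontier, h₁, h₂⟩

theorem IsAlmostRegularModelSet.finite_inter [IsTopologicalAddGroup G] [T2Space G] {Γ : Set G}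
    (h : IsAlmostRegularModelSet Γ) {C : Set G} (hC : IsCompact C) : (Γ ∩ C).Finite := by
  obtain ⟨H, _, _, _, _, _, _, _, S, U, W, -, -, -, hW, -, -, hΓW⟩ := h
  exact (S.finite_projectionSet_inter hW hC).subset (inter_subset_inter_left C hΓW)

/-- If the lattice of the cut-and-project scheme embeds into a compact group such that all the
subsets of the image of the lattice in the extended internal space are Borel, then every set
`Λ_U ⊆ Γ ⊆ Λ_W` is a regular model set with respect to the extended scheme. -/
theorem CutAndProjectScheme.isRegularModelSet_of_measurableSet [IsTopologicalAddGroup G]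
    [LocallyCompactSpace G] {H K : Type u} [AddCommGroup H] [TopologicalSpace H]
    [IsTopologicalAddGroup H] [LocallyCompactSpace H] [T2Space H] [MeasurableSpace H]
    [BorelSpace H] [AddCommGroup K] [TopologicalSpace K] [IsTopologicalAddGroup K]
    [CompactSpace K] [T2Space K] (S : CutAndProjectScheme G H) (ψ : S.lattice →+ K)
    (hψ : Function.Injective ψ)
    (hmeas : ∀ E ⊆ range (S.internalMk ψ), MeasurableSet[borel (S.InternalExtension ψ)] E)
    {U W : Set H} (hUW : U ⊆ W) (hUne : U.Nonempty) (hU : IsOpen U) (hW : IsCompact W)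
    (h0 : Measure.addHaar (W \ U) = 0) {Γ : Set G} (hUΓ : S.projectionSet U ⊆ Γ)
    (hΓW : Γ ⊆ S.projectionSet W) : IsRegularModelSet Γ := by
  have hmk : Function.Injective (S.internalMk ψ) := fun l l' hl =>
    hψ (congrArg (S.internalCoord ψ) hl)
  let p := S.internalProj ψ
  have hp : IsProperMap p := S.isProperMap_internalProj ψ
  let mX : MeasurableSpace (S.InternalExtension ψ) := borel _
  have bX : BorelSpace (S.InternalExtension ψ) := ⟨rfl⟩
  let E : Set (S.InternalExtension ψ) := S.internalMk ψ '' {l | (l : G × H).1 ∈ Γ}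
  have hE : MeasurableSet E := hmeas E (image_subset_range _ _)
  have hEW : E ⊆ p ⁻¹' W := by
    rintro _ ⟨l, hl, rfl⟩
    obtain ⟨l', ⟨hl', -, hlW⟩, hll'⟩ := hΓW hl
    have : l' = (l : G × H) := S.injOn_fst hl' l.2 hll'
    change (l : G × H).2 ∈ W
    rwa [← this]
  let V := p ⁻¹' U ∪ E
  have hUo : IsOpen (p ⁻¹' U) := hU.preimage hp.continuous
  have hWc : IsCompact (p ⁻¹' W) := hp.isCompact_preimage hW
  have hVW : closure V ⊆ p ⁻¹' W :=
    closure_minimal (union_subset (preimage_mono hUW) hEW) (hW.isClosed.preimage hp.continuous)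
  have hUV : p ⁻¹' U ⊆ interior V := interior_maximal subset_union_left hUo
  have hnull : Measure.addHaar (p ⁻¹' (W \ U)) = 0 :=
    S.addHaar_preimage_internalProj_eq_zero ψ (hW.diff hU) h0
  have hfr : frontier V ⊆ p ⁻¹' (W \ U) := fun x hx => ⟨hVW hx.1, fun hxU => hx.2 (hUV hxU)⟩
  have hV : IsRegularWindow V := by
    refine ⟨?_, ?_, ?_, ?_⟩
    · exact hWc.of_isClosed_subset isClosed_closure hVW
    · exact hUo.measurableSet.union hE
    · exact (hUne.preimage (S.surjective_internalProj ψ)).mono hUV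
    · exact measure_mono_null hfr hnull
  have hΓ : Γ = (S.extend ψ).projectionSet V := by
    ext g
    rw [S.mem_projectionSet_extend ψ]
    constructor
    · intro hg
      obtain ⟨l, ⟨hl, -, -⟩, rfl⟩ := hΓW hg
      exact ⟨⟨l, hl⟩, Or.inr ⟨⟨l, hl⟩, hg, rfl⟩, rfl⟩
    · rintro ⟨l, hl | ⟨l', hl', hll'⟩, rfl⟩
      · exact hUΓ ⟨l, ⟨l.2, trivial, hl⟩, rfl⟩
      -- Injectivity of `ψ` matters here: a point of `E` comes from only one lattice point.
      · exact hmk hll' ▸ hl'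
  exact ⟨_, _, _, _, _, inferInstance, mX, bX, S.extend ψ, V, hV, hΓ⟩

/-- An almost regular model set is a regular model set for a larger internal space: the lattice is
mapped injectively to a power of the circle such that the image is `σ`-discrete, and the closure of
the graph of this map is the new internal space. There any set between the preimages of the two
windows that differs from the smaller one by lattice points only is Borel. -/
theorem IsAlmostRegularModelSet.isRegularModelSet [IsTopologicalAddGroup G]
    [LocallyCompactSpace G] {Γ : Set G}
    (h : IsAlmostRegularModelSet Γ) : IsRegularModelSet Γ := by
  obtain ⟨H, _, _, _, _, _, _, _, S, U, W, hUW, hUne, hU, hW, h0, hUΓ, hΓW⟩ := h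
  obtain ⟨ι, f, hf⟩ := exists_injective_addMonoidHom_finsupp S.lattice
  let ψ : S.lattice →+ (ι → UnitAddCircle) :=
    { toFun := fun l i => f l i
      map_zero' := by ext; simp
      map_add' := fun l l' => by ext; simp }
  have hψ : Function.Injective ψ := fun l l' hl =>
    hf (Finsupp.ext fun i => Subtype.ext (congrFun hl i))
  have hmk : Function.Injective (S.internalMk ψ) := fun l l' hl =>
    hψ (congrArg (S.internalCoord ψ) hl)
  refine S.isRegularModelSet_of_measurableSet ψ hψ (fun E hE => ?_) hUW hUne hU hW h0 hUΓ hΓW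
  let mX : MeasurableSpace (S.InternalExtension ψ) := borel _
  have bX : BorelSpace (S.InternalExtension ψ) := ⟨rfl⟩
  -- On `E` the inverse of `internalMk` recovers the lattice point; its values elsewhere are
  -- irrelevant.
  refine measurableSet_of_injOn_finsupp (S.continuous_internalCoord ψ)
    (a := f ∘ Function.invFun (S.internalMk ψ)) ?_ ?_
  · intro x hx y hy hxy
    obtain ⟨l, rfl⟩ := hE hx
    obtain ⟨l', rfl⟩ := hE hy
    simp only [Function.comp_apply, Function.leftInverse_invFun hmk _] at hxy
    rw [hf hxy]
  · intro x hx i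
    obtain ⟨l, rfl⟩ := hE hx
    simp only [Function.comp_apply, Function.leftInverse_invFun hmk _]
    rfl

end

theorem mainTheorem7 {G : Type u} [AddCommGroup G] [TopologicalSpace G] [IsTopologicalAddGroup G]
    [LocallyCompactSpace G] [T2Space G] (Γ : Set G) :
    (IsAlmostRegularModelSet Γ → ∃ Γ' ∈ hull Γ, IsRegularModelSet Γ') ∧
      (IsInterRegularModelSet Γ → ∃ Γ' ∈ hull Γ, IsRegularModelSet Γ') := by
  have key : IsAlmostRegularModelSet Γ → ∃ Γ' ∈ hull Γ, IsRegularModelSet Γ' := fun h =>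
    ⟨Γ, mem_hull_self fun _ hC => h.finite_inter hC, h.isRegularModelSet⟩
  exact ⟨key, fun h => key h.isAlmostRegularModelSet⟩
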